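/- Let $\mathcal H$ be a finite-dimensional complex Hilbert space and let $A_0,\dots,A_{d-1}$ be linear operators on $\mathcal H$ with $\sum_{x=0}^{d-1}A_x^\dagger A_x=\mathbb 1$. Say that $\{A_x\}$ satisfies the *purity condition* if every nonzero orthogonal projector $P$ on $\mathcal H$ such that $$PA_{x_1}^\dagger\cdots A_{x_N}^\dagger A_{x_N}\cdots A_{x_1}P\in\mathbb C P\qquad\text{for all }N\in\mathbb N\text{ and all }(x_1,\dots,x_N)\in\{0,\dots,d-1\}^N$$ has rank one. Let $\nu_1(T)\ge\nu_2(T)\ge\cdots$ denote the singular values of an operator $T$, counted with multiplicity ($\nu_2(T):=0$ if there are fewer than two). Define $$w(N)=\sum_{x_1,\dots,x_N=0}^{d-1}\nu_1(A_{x_N}\cdots A_{x_1})\,\nu_2(A_{x_N}\cdots A_{x_1}),$$ and, for a positive operator $\sigma$ on $\mathcal H$ and a linear map $F:\mathcal H\to\mathcal H'$ into a finite-dimensional complex Hilbert space $\mathcal H'$, $$f_{\sigma,F}(N)=\sum_{x_1,\dots,x_N=0}^{d-1}\nu_1(FA_{x_N}\cdots A_{x_1}\sqrt\sigma)\,\nu_2(FA_{x_N}\cdots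 A_{x_1}\sqrt\sigma).$$ Then: 1. If $\{A_x\}$ satisfies the purity condition, then there are real constants $\overline c\ge 0$ and $0<\gamma<1$ such that $f_{\sigma,F}(N)\le\overline c\,\gamma^N$ for all $N\in\mathbb N$, all density operators $\sigma$ on $\mathcal H$ (positive with trace one), all $\mathcal H'$, and all $F:\mathcal H\to\mathcal H'$ with $F^\dagger F\le\mathbb 1$. 2. Conversely, if for some $\mathcal H'$, some positive operator $\sigma$ on $\mathcal H$ and some $F:\mathcal H\to\mathcal H'$ such that $\sigma$ and $F^\dagger F$ have full rank there are constants $\overline c_{\sigma,F}\ge 0$ and $0<\gamma<1$ with $f_{\sigma,F}(N)\le\overline c_{\sigma,F}\,\gamma^N$ for all $N\in\mathbb N$, then $\{A_x\}$ satisfies the purity condition. 3. The following are equivalent: (a) $\{A_x\}$ satisfies the purity condition; (b) $\lim_{N\to\infty}w(N)=0$; (c) there are real constants $C\ge 0$ and $0<\gamma<1$ with $w(N)\le C\gamma^N$ for all $N\in\mathbb N$. -/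

import Mathlib

open Filter Topology

universe u v

noncomputable section

namespace RandomProducts

variable {H : Type u} [NormedAddCommGroup H] [InnerProductSpace ℂ H]

/-- The product `A_{x_N} ⋯ A_{x_1}` along a word `x = (x_1, …, x_N)`; the operator of the first
letter acts first. The entry `x i` of a word is the letter with number `i + 1`. -/
def wordProd {d : ℕ} (A : Fin d → H →L[ℂ] H) : (N : ℕ) → (Fin N → Fin d) → H →L[ℂ] H
  | 0, _ => 1
  | N + 1, x => A (x (Fin.last N)) * wordProd A N (fun i => x i.castSucc)

/-- The rank of an operator. -/
def opRank (T : H →L[ℂ] H) : ℕ :=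
  Module.finrank ℂ (LinearMap.range (T : H →ₗ[ℂ] H))

/-- An operator on `H` has full rank if its rank is the dimension of `H`. -/
def IsFullRank (T : H →L[ℂ] H) : Prop :=
  opRank T = Module.finrank ℂ H

/-- The product `ν₁(T) ν₂(T)` of the two largest singular values of `T`, counted with multiplicity.
Mathlib numbers singular values from `0`, in decreasing order, one for each dimension of the
domain, and continues the list by zeros. -/
def topTwo {H' : Type v} [NormedAddCommGroup H'] [InnerProductSpace ℂ H']
    [FiniteDimensional ℂ H] [FiniteDimensional ℂ H'] (T : H →L[ℂ] H') : ℝ :=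
  (T : H →ₗ[ℂ] H').singularValues 0 * (T : H →ₗ[ℂ] H').singularValues 1

/-- `w(N) = ∑_{x_1, …, x_N} ν₁(A_{x_N} ⋯ A_{x_1}) ν₂(A_{x_N} ⋯ A_{x_1})`. -/
def w [FiniteDimensional ℂ H] {d : ℕ} (A : Fin d → H →L[ℂ] H) (N : ℕ) : ℝ :=
  ∑ x : Fin N → Fin d, topTwo (wordProd A N x)

variable [CompleteSpace H]

/-- The purity condition: the only nonzero orthogonal projectors `P` for which
`P A_{x_1}† ⋯ A_{x_N}† A_{x_N} ⋯ A_{x_1} P` is a scalar multiple of `P` for every word are those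
of rank one. (The zero projector has this proportionality for trivial reasons.) -/
def Purity {d : ℕ} (A : Fin d → H →L[ℂ] H) : Prop :=
  ∀ P : H →L[ℂ] H, IsStarProjection P → P ≠ 0 →
    (∀ (N : ℕ) (x : Fin N → Fin d), ∃ c : ℂ,
      P * star (wordProd A N x) * wordProd A N x * P = c • P) →
    opRank P = 1

/-- A density operator: positive, with trace one. -/
def IsDensityOperator (σ : H →L[ℂ] H) : Prop :=
  σ.IsPositive ∧ LinearMap.trace ℂ H (σ : H →ₗ[ℂ] H) = 1

/-- `f(N) = ∑_{x_1, …, x_N} ν₁(F A_{x_N} ⋯ A_{x_1} √σ) ν₂(F A_{x_N} ⋯ A_{x_1} √σ)`, for a positive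
operator `σ`. -/
def f {H' : Type v} [NormedAddCommGroup H'] [InnerProductSpace ℂ H']
    [FiniteDimensional ℂ H] [FiniteDimensional ℂ H'] {d : ℕ}
    (A : Fin d → H →L[ℂ] H) (σ : H →L[ℂ] H) (F : H →L[ℂ] H') (N : ℕ) : ℝ :=
  ∑ x : Fin N → Fin d, topTwo (F ∘L wordProd A N x ∘L CFC.sqrt σ)

end RandomProducts

end

/-! The product `ν₁(T) ν₂(T)` is the operator norm of `T ∧ T` on bivectors, so everything is
expressed by areas `‖u ∧ v‖` (`exists_topTwo_eq_area`, `area_map_le_topTwo`).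

For an orthonormal pair, the area of its image under a product `W` is at most `(‖W u‖ ^ 2 + ‖W v‖ ^
2) / 2`, and by `∑ A†A = 1` these bounds sum to one over all words of a given length. Hence the
total area never grows, and it stays one only if every `W` is a multiple of an isometry on the span
of `u` and `v`. The projector onto that span would then violate purity. So under purity every
orthonormal pair loses area at some length; compactness makes the length and the factor uniform
(`exists_areaSum_contraction`), and iteration gives exponential decay of `w`.

If purity fails, an orthonormal pair in the range of an offending projector keeps total area one, so
`w N ≥ 1` for all `N` (`one_le_w_of_not_purity`). Finally `f ≤ w` for the `σ`, `F` of part 1, and `w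
≤ K f` when `σ` and `F†F` have full rank. -/

noncomputable section

namespace RandomProducts

/-! ### Areas of parallelograms. -/

section Area

variable {E : Type*} [NormedAddCommGroup E] [InnerProductSpace ℂ E]
  {E' : Type*} [NormedAddCommGroup E'] [InnerProductSpace ℂ E']

/-- The area `‖u ∧ v‖` of the parallelogram spanned by `u` and `v`. -/
def area (u v : E) : ℝ := √(‖u‖ ^ 2 * ‖v‖ ^ 2 - ‖inner ℂ u v‖ ^ 2)

theorem gram_nonneg (u v : E) : 0 ≤ ‖u‖ ^ 2 * ‖v‖ ^ 2 - ‖inner ℂ u v‖ ^ 2 := by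
  have h := norm_inner_le_norm (𝕜 := ℂ) u v
  have := pow_le_pow_left₀ (norm_nonneg _) h 2
  rw [mul_pow] at this
  linarith

theorem area_nonneg (u v : E) : 0 ≤ area u v := Real.sqrt_nonneg _

theorem area_sq (u v : E) : area u v ^ 2 = ‖u‖ ^ 2 * ‖v‖ ^ 2 - ‖inner ℂ u v‖ ^ 2 :=
  Real.sq_sqrt (gram_nonneg u v)

theorem area_sq_complex (u v : E) :
    ((area u v ^ 2 : ℝ) : ℂ) = inner ℂ u u * inner ℂ v v - inner ℂ u v * inner ℂ v u := by
  rw [area_sq, inner_self_eq_norm_sq_to_K, inner_self_eq_norm_sq_to_K,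
    ← inner_conj_symm v u, Complex.mul_conj, Complex.normSq_eq_norm_sq]
  push_cast
  rfl

theorem area_le_mul_norm (u v : E) : area u v ≤ ‖u‖ * ‖v‖ := by
  refine Real.sqrt_le_iff.2 ⟨by positivity, ?_⟩
  nlinarith [sq_nonneg ‖inner ℂ u v‖]

theorem area_of_inner_eq_zero {u v : E} (h : inner ℂ u v = 0) : area u v = ‖u‖ * ‖v‖ := by
  rw [area, h, norm_zero, zero_pow two_ne_zero, sub_zero, ← mul_pow, Real.sqrt_sq (by positivity)]

/-- The bivector is multiplied by the determinant of the substitution; symmetry, scaling and shear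
invariance are special cases. -/
theorem area_linear_comb (u v : E) (a b c e : ℂ) :
    area (a • u + b • v) (c • u + e • v) = ‖a * e - b * c‖ * area u v := by
  rw [← sq_eq_sq₀ (area_nonneg _ _) (mul_nonneg (norm_nonneg _) (area_nonneg _ _)), mul_pow,
    ← Complex.ofReal_inj, Complex.ofReal_mul, area_sq_complex, area_sq_complex,
    ← Complex.normSq_eq_norm_sq, ← Complex.mul_conj]
  simp only [inner_add_left, inner_add_right, inner_smul_left, inner_smul_right, map_sub, map_mul]
  ring

theorem area_comm (u v : E) : area u v = area v u := by
  have := area_linear_comb v u 0 1 1 0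
  simpa using this

theorem area_smul_smul (u v : E) (a e : ℂ) : area (a • u) (e • v) = ‖a‖ * ‖e‖ * area u v := by
  have := area_linear_comb u v a 0 0 e
  simpa using this

theorem area_sub_smul (u v : E) (c : ℂ) : area u (v - c • u) = area u v := by
  have := area_linear_comb u v 1 0 (-c) 1
  simpa [sub_eq_neg_add] using this

/-- The component of `v` orthogonal to `u`. -/
def orthComp (u v : E) : E := v - (inner ℂ u v / (‖u‖ ^ 2 : ℝ)) • u

theorem inner_orthComp (u v : E) : inner ℂ u (orthComp u v) = 0 := by
  rcases eq_or_ne u 0 with rfl | hu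
  · simp
  · have : ((‖u‖ : ℝ) : ℂ) ≠ 0 := by simpa using hu
    rw [orthComp, inner_sub_right, inner_smul_right, inner_self_eq_norm_sq_to_K]
    push_cast
    simp only [Complex.coe_algebraMap]
    field_simp
    simp

theorem area_eq_norm_mul (u v : E) : area u v = ‖u‖ * ‖orthComp u v‖ := by
  rw [← area_of_inner_eq_zero (inner_orthComp u v), orthComp, area_sub_smul]

theorem area_map_orthComp (L : E →ₗ[ℂ] E') (u v : E) :
    area (L u) (L (orthComp u v)) = area (L u) (L v) := by
  rw [orthComp, map_sub, map_smul, area_sub_smul]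

/-- `orthComp u` is linear, so this is the triangle inequality for it. -/
theorem area_sum_smul_le {ι : Type*} (s : Finset ι) (u : E) (c : ι → ℂ) (v : ι → E) :
    area u (∑ i ∈ s, c i • v i) ≤ ∑ i ∈ s, ‖c i‖ * area u (v i) := by
  have : orthComp u (∑ i ∈ s, c i • v i) = ∑ i ∈ s, c i • orthComp u (v i) := by
    simp only [orthComp, inner_sum, inner_smul_right, smul_sub, Finset.sum_sub_distrib, smul_smul,
      Finset.sum_div, Finset.sum_smul, mul_div_assoc]
  rw [area_eq_norm_mul, this]
  calc ‖u‖ * ‖∑ i ∈ s, c i • orthComp u (v i)‖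
      ≤ ‖u‖ * ∑ i ∈ s, ‖c i • orthComp u (v i)‖ := by gcongr; exact norm_sum_le _ _
    _ = _ := by
      rw [Finset.mul_sum]
      refine Finset.sum_congr rfl fun i _ => ?_
      rw [norm_smul, area_eq_norm_mul]; ring

theorem area_sum_sum_le {ι : Type*} [Fintype ι] (e : ι → E) (a b : ι → ℂ)
    (ha : ∀ i, ‖a i‖ ≤ 1) (hb : ∀ i, ‖b i‖ ≤ 1) :
    area (∑ i, a i • e i) (∑ i, b i • e i) ≤ ∑ i, ∑ j, area (e i) (e j) := by
  refine (area_sum_smul_le _ _ _ _).trans ?_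
  rw [Finset.sum_comm]
  refine Finset.sum_le_sum fun j _ => ?_
  refine (mul_le_of_le_one_left (area_nonneg _ _) (hb j)).trans ?_
  rw [area_comm]
  refine (area_sum_smul_le _ _ _ _).trans (Finset.sum_le_sum fun i _ => ?_)
  rw [area_comm (e i)]
  exact mul_le_of_le_one_left (area_nonneg _ _) (ha i)

/-- Shear invariance allows `v` to be replaced by its orthogonal component, so two different factors
`s` and `t` can be used; later they are `ν₂` and `ν₁`. -/
theorem area_map_le_of_norm_le {L : E →ₗ[ℂ] E'} {u v : E} {s t : ℝ}
    (hu : ‖L u‖ ≤ s * ‖u‖) (hv : ‖L (orthComp u v)‖ ≤ t * ‖orthComp u v‖) :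
    area (L u) (L v) ≤ s * t * area u v := by
  rw [← area_map_orthComp, area_eq_norm_mul u v]
  calc _ ≤ _ := area_le_mul_norm _ _
    _ ≤ (s * ‖u‖) * (t * ‖orthComp u v‖) :=
      mul_le_mul hu hv (norm_nonneg _) ((norm_nonneg _).trans hu)
    _ = _ := by ring

theorem area_map_le (L : E →L[ℂ] E') (u v : E) : area (L u) (L v) ≤ ‖L‖ * ‖L‖ * area u v :=
  area_map_le_of_norm_le (L := (L : E →ₗ[ℂ] E')) (L.le_opNorm _) (L.le_opNorm _)

@[fun_prop]
theorem continuous_area {X : Type*} [TopologicalSpace X] {a b : X → E}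
    (ha : Continuous a) (hb : Continuous b) : Continuous fun x => area (a x) (b x) := by
  unfold area
  fun_prop

/-- A pair of vectors of positive area is a multiple, as a bivector, of an orthonormal pair. -/
theorem exists_orthonormal_area {u v : E} (h : area u v ≠ 0) :
    ∃ u' v' : E, ‖u'‖ = 1 ∧ ‖v'‖ = 1 ∧ inner ℂ u' v' = 0 ∧
      ∀ L : E →L[ℂ] E, area (L u) (L v) = area u v * area (L u') (L v') := by
  have h' := h
  rw [area_eq_norm_mul] at h'
  have h1 := left_ne_zero_of_mul h'
  have h2 := right_ne_zero_of_mul h'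
  refine ⟨((‖u‖⁻¹ : ℝ) : ℂ) • u, ((‖orthComp u v‖⁻¹ : ℝ) : ℂ) • orthComp u v, ?_, ?_, ?_, ?_⟩
  · rw [norm_smul, Complex.norm_real, norm_inv, norm_norm, inv_mul_cancel₀ h1]
  · rw [norm_smul, Complex.norm_real, norm_inv, norm_norm, inv_mul_cancel₀ h2]
  · rw [inner_smul_left, inner_smul_right, inner_orthComp, mul_zero, mul_zero]
  · intro L
    have := area_map_orthComp (L : E →ₗ[ℂ] E) u v
    simp only [ContinuousLinearMap.coe_coe] at this
    rw [map_smul, map_smul, area_smul_smul, this, area_eq_norm_mul u v]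
    simp only [Complex.norm_real, norm_inv, norm_norm]
    field_simp

end Area

/-! ### `ν₁ ν₂` as the norm on bivectors. -/

section TopTwo

variable {E : Type*} [NormedAddCommGroup E] [InnerProductSpace ℂ E] [FiniteDimensional ℂ E]
  {E' : Type*} [NormedAddCommGroup E'] [InnerProductSpace ℂ E'] [FiniteDimensional ℂ E']

theorem topTwo_nonneg (T : E →L[ℂ] E') : 0 ≤ topTwo T :=
  mul_nonneg (LinearMap.singularValues_nonneg _ _) (LinearMap.singularValues_nonneg _ _)

theorem inner_map_eigenvectorBasis (T : E →ₗ[ℂ] E') {n : ℕ} (hn : Module.finrank ℂ E = n)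
    (i : Fin n) (x : E) :
    inner ℂ (T (T.isSymmetric_adjoint_comp_self.eigenvectorBasis hn i)) (T x) =
      (T.singularValues i ^ 2 : ℝ) *
        inner ℂ (T.isSymmetric_adjoint_comp_self.eigenvectorBasis hn i) x := by
  rw [← LinearMap.adjoint_inner_left, ← LinearMap.comp_apply,
    LinearMap.IsSymmetric.apply_eigenvectorBasis, inner_smul_left, T.sq_singularValues_fin hn]
  simp

theorem norm_map_sq_eq_sum (T : E →ₗ[ℂ] E') {n : ℕ} (hn : Module.finrank ℂ E = n) (x : E) :
    ‖T x‖ ^ 2 = ∑ i : Fin n, T.singularValues i ^ 2 *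
      ‖inner ℂ (T.isSymmetric_adjoint_comp_self.eigenvectorBasis hn i) x‖ ^ 2 := by
  have hb := (T.isSymmetric_adjoint_comp_self.eigenvectorBasis hn).sum_repr' x
  set b := T.isSymmetric_adjoint_comp_self.eigenvectorBasis hn with hbdef
  apply Complex.ofReal_injective
  have : ((‖T x‖ ^ 2 : ℝ) : ℂ) = inner ℂ (T x) (T x) := by
    rw [inner_self_eq_norm_sq_to_K]; simp
  rw [this]
  nth_rewrite 1 [← hb]
  rw [map_sum, sum_inner, Complex.ofReal_sum]
  refine Finset.sum_congr rfl fun i _ => ?_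
  rw [map_smul, inner_smul_left, inner_map_eigenvectorBasis T hn, ← hbdef, Complex.ofReal_mul,
    ← Complex.normSq_eq_norm_sq (inner ℂ (b i) x), ← Complex.mul_conj]
  ring

/-- Only the singular values with index at least `k` contribute to `norm_map_sq_eq_sum`. -/
theorem norm_map_le_singularValues (T : E →ₗ[ℂ] E') {n : ℕ} (hn : Module.finrank ℂ E = n)
    (k : ℕ) (x : E)
    (hx : ∀ i : Fin n, (i : ℕ) < k →
      inner ℂ (T.isSymmetric_adjoint_comp_self.eigenvectorBasis hn i) x = 0) :
    ‖T x‖ ≤ T.singularValues k * ‖x‖ := by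
  refine le_of_sq_le_sq ?_ (mul_nonneg (T.singularValues_nonneg k) (norm_nonneg x))
  rw [norm_map_sq_eq_sum T hn, mul_pow,
    ← (T.isSymmetric_adjoint_comp_self.eigenvectorBasis hn).sum_sq_norm_inner_right x,
    Finset.mul_sum]
  refine Finset.sum_le_sum fun i _ => ?_
  rcases lt_or_ge (i : ℕ) k with h | h
  · simp [hx i h]
  · have := T.singularValues_antitone h
    have h0 := T.singularValues_nonneg i
    gcongr

theorem exists_topTwo_eq_area (T : E →L[ℂ] E') :
    ∃ u v : E, ‖u‖ ≤ 1 ∧ ‖v‖ ≤ 1 ∧ topTwo T = area (T u) (T v) := by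
  rcases lt_or_ge (Module.finrank ℂ E) 2 with h | h
  · refine ⟨0, 0, by simp, by simp, ?_⟩
    rw [topTwo, LinearMap.singularValues_of_finrank_le _ (by omega : _ ≤ 1)]
    simp [area]
  · set S : E →ₗ[ℂ] E' := T.toLinearMap with hS
    set b := S.isSymmetric_adjoint_comp_self.eigenvectorBasis rfl with hb
    have hnorm (i : Fin (Module.finrank ℂ E)) : ‖S (b i)‖ = S.singularValues i := by
      refine le_antisymm ?_ ?_
      · have := norm_map_le_singularValues S rfl i (b i) fun j hj => ?_
        · simpa using this
        · rw [← hb, b.inner_eq_ite, if_neg (by rintro rfl; exact lt_irrefl _ hj)]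
      · refine le_of_sq_le_sq ?_ (norm_nonneg _)
        have h1 := inner_map_eigenvectorBasis S rfl i (b i)
        rw [← hb, inner_self_eq_norm_sq_to_K, inner_self_eq_norm_sq_to_K, b.norm_eq_one] at h1
        have h2 : ‖S (b i)‖ ^ 2 = S.singularValues i ^ 2 := by
          apply Complex.ofReal_injective
          simpa using h1
        exact h2.ge
    -- The first two right singular vectors have orthogonal images of norms `ν₁` and `ν₂`.
    refine ⟨b ⟨0, by omega⟩, b ⟨1, by omega⟩, by simp, by simp, ?_⟩
    change _ = area (S _) (S _)
    rw [area_of_inner_eq_zero, hnorm, hnorm, topTwo]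
    rw [inner_map_eigenvectorBasis S rfl, ← hb, b.inner_eq_ite, if_neg (by simp), mul_zero]

/-- A plane always contains a nonzero vector orthogonal to the top right singular vector. `T`
stretches it by at most `ν₂`, and its orthogonal complement in the plane by at most `ν₁`. -/
theorem area_map_le_topTwo (T : E →L[ℂ] E') (a b : E) :
    area (T a) (T b) ≤ topTwo T * area a b := by
  rcases Nat.eq_zero_or_pos (Module.finrank ℂ E) with h | h
  · have : Subsingleton E := Module.finrank_zero_iff.1 h
    simp [Subsingleton.elim a 0, Subsingleton.elim b 0, area]
  set S : E →ₗ[ℂ] E' := T.toLinearMap with hS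
  set e := S.isSymmetric_adjoint_comp_self.eigenvectorBasis rfl with he
  have key (y z : E) (hy : inner ℂ (e ⟨0, h⟩) y = 0) : area (S y) (S z) ≤ topTwo T * area y z := by
    rw [topTwo, mul_comm (T.toLinearMap.singularValues 0)]
    refine area_map_le_of_norm_le ?_ ?_
    · refine norm_map_le_singularValues S rfl 1 y fun i hi => ?_
      obtain rfl : i = ⟨0, h⟩ := Fin.ext (by simpa using hi)
      exact hy
    · exact norm_map_le_singularValues S rfl 0 _ fun i hi => by simp at hi
  rcases eq_or_ne (inner ℂ (e ⟨0, h⟩) a) 0 with h0 | h0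
  · exact key a b h0
  -- This combination is orthogonal to the top singular vector, and the shear does not change areas.
  · have := key (b - (inner ℂ (e ⟨0, h⟩) b / inner ℂ (e ⟨0, h⟩) a) • a) a (by
      rw [inner_sub_right, inner_smul_right, div_mul_cancel₀ _ h0, sub_self])
    rwa [map_sub, map_smul, area_comm, area_sub_smul, area_comm _ a, area_sub_smul] at this

theorem topTwo_comp_le {D : Type*} [NormedAddCommGroup D] [InnerProductSpace ℂ D]
    [FiniteDimensional ℂ D] {D' : Type*} [NormedAddCommGroup D'] [InnerProductSpace ℂ D']
    [FiniteDimensional ℂ D'] (L : E' →L[ℂ] D') (T : E →L[ℂ] E') (R : D →L[ℂ] E) :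
    topTwo (L ∘L T ∘L R) ≤ (‖L‖ * ‖L‖) * (‖R‖ * ‖R‖) * topTwo T := by
  obtain ⟨u, v, hu, hv, h⟩ := exists_topTwo_eq_area (L ∘L T ∘L R)
  have hT := topTwo_nonneg T
  rw [h]
  calc area (L (T (R u))) (L (T (R v)))
      ≤ ‖L‖ * ‖L‖ * area (T (R u)) (T (R v)) := area_map_le _ _ _
    _ ≤ ‖L‖ * ‖L‖ * (topTwo T * (‖R‖ * ‖R‖ * area u v)) := by
      gcongr
      refine (area_map_le_topTwo _ _ _).trans ?_
      gcongr
      exact area_map_le _ _ _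
    _ ≤ ‖L‖ * ‖L‖ * (topTwo T * (‖R‖ * ‖R‖ * 1)) := by
      gcongr
      exact (area_le_mul_norm u v).trans (mul_le_one₀ hu (norm_nonneg _) hv)
    _ = _ := by ring

end TopTwo

variable {H : Type u} [NormedAddCommGroup H] [InnerProductSpace ℂ H]

/-! ### Products along words and the normalization. -/

section Words

variable {d : ℕ} (A : Fin d → H →L[ℂ] H)

theorem sum_wordProd_succ {M : Type*} [AddCommMonoid M] (φ : (H →L[ℂ] H) → M) (N : ℕ) :
    ∑ x, φ (wordProd A (N + 1) x) = ∑ x, ∑ a, φ (A a * wordProd A N x) := by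
  rw [← (Fin.snocEquiv fun _ : Fin (N + 1) => Fin d).sum_comp, Fintype.sum_prod_type_right]
  simp [wordProd, Fin.snocEquiv]

theorem sum_wordProd_add {M : Type*} [AddCommMonoid M] (φ : (H →L[ℂ] H) → M) (N p : ℕ) :
    ∑ x, φ (wordProd A (N + p) x) = ∑ x, ∑ y, φ (wordProd A p y * wordProd A N x) := by
  induction p generalizing φ with
  | zero => simp [wordProd]
  | succ p ih =>
    have := sum_wordProd_succ A φ (N + p)
    rw [← Nat.add_assoc, this, ih fun T => ∑ a, φ (A a * T)]
    refine Finset.sum_congr rfl fun x _ => ?_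
    rw [sum_wordProd_succ A (fun T => φ (T * wordProd A N x))]
    simp only [mul_assoc]

variable [CompleteSpace H]

theorem sum_norm_sq_apply (hA : ∑ x, star (A x) * A x = 1) (u : H) :
    ∑ a, ‖A a u‖ ^ 2 = ‖u‖ ^ 2 := by
  apply Complex.ofReal_injective
  have h : ∑ a, inner ℂ u ((star (A a) * A a) u) = inner ℂ u u := by
    rw [← inner_sum, ← sum_apply, hA, one_apply_eq_self]
  rw [inner_self_eq_norm_sq_to_K] at h
  push_cast
  refine Eq.trans (Finset.sum_congr rfl fun a _ => ?_) h
  rw [mul_apply_eq_comp, ContinuousLinearMap.star_eq_adjoint,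
    ContinuousLinearMap.adjoint_inner_right, inner_self_eq_norm_sq_to_K]
  rfl

theorem sum_norm_sq_wordProd (hA : ∑ x, star (A x) * A x = 1) (N : ℕ) (u : H) :
    ∑ x, ‖wordProd A N x u‖ ^ 2 = ‖u‖ ^ 2 := by
  induction N with
  | zero => simp [wordProd]
  | succ N ih =>
    rw [sum_wordProd_succ A fun T => ‖T u‖ ^ 2, ← ih]
    exact Finset.sum_congr rfl fun x _ => sum_norm_sq_apply A hA _

end Words

/-! ### Total area and its loss under purity. -/

section AreaSum

variable {d : ℕ} (A : Fin d → H →L[ℂ] H)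

/-- The total area of the images of a pair of vectors under the products along words. -/
def areaSum (N : ℕ) (u v : H) : ℝ := ∑ x, area (wordProd A N x u) (wordProd A N x v)

theorem areaSum_nonneg (N : ℕ) (u v : H) : 0 ≤ areaSum A N u v :=
  Finset.sum_nonneg fun _ _ => area_nonneg _ _

theorem areaSum_add (N p : ℕ) (u v : H) :
    areaSum A (N + p) u v = ∑ x, areaSum A p (wordProd A N x u) (wordProd A N x v) :=
  sum_wordProd_add A (fun T => area (T u) (T v)) N p

theorem continuous_areaSum (N : ℕ) : Continuous fun q : H × H => areaSum A N q.1 q.2 := by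
  unfold areaSum
  fun_prop

/-- A bound on orthonormal pairs extends to all pairs. -/
theorem areaSum_le_of_orthonormal {N : ℕ} {θ : ℝ}
    (h : ∀ u v : H, ‖u‖ = 1 → ‖v‖ = 1 → inner ℂ u v = 0 → areaSum A N u v ≤ θ) (u v : H) :
    areaSum A N u v ≤ θ * area u v := by
  rcases eq_or_ne (area u v) 0 with h0 | h0
  -- A pair of area zero has images of area zero, so both sides vanish.
  · refine le_of_eq ?_
    rw [h0, mul_zero]
    refine Finset.sum_eq_zero fun x _ => le_antisymm ?_ (area_nonneg _ _)
    simpa [h0] using area_map_le (wordProd A N x) u v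
  · obtain ⟨u', v', hu, hv, huv, hL⟩ := exists_orthonormal_area h0
    have : areaSum A N u v = area u v * areaSum A N u' v' := by
      rw [areaSum, areaSum, Finset.mul_sum]
      exact Finset.sum_congr rfl fun x _ => hL _
    rw [this, mul_comm]
    exact mul_le_mul_of_nonneg_right (h u' v' hu hv huv) (area_nonneg _ _)

variable [CompleteSpace H]

theorem areaSum_le_one (hA : ∑ x, star (A x) * A x = 1) (N : ℕ) {u v : H} (hu : ‖u‖ = 1)
    (hv : ‖v‖ = 1) : areaSum A N u v ≤ 1 := by
  have h1 := sum_norm_sq_wordProd A hA N u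
  have h2 := sum_norm_sq_wordProd A hA N v
  calc areaSum A N u v
      ≤ ∑ x, (‖wordProd A N x u‖ ^ 2 + ‖wordProd A N x v‖ ^ 2) / 2 :=
        Finset.sum_le_sum fun x _ => (area_le_mul_norm _ _).trans (by
          nlinarith [sq_nonneg (‖wordProd A N x u‖ - ‖wordProd A N x v‖)])
    _ = 1 := by
      rw [← Finset.sum_div, Finset.sum_add_distrib, h1, h2, hu, hv]; norm_num

theorem areaSum_le_area (hA : ∑ x, star (A x) * A x = 1) (N : ℕ) (u v : H) :
    areaSum A N u v ≤ area u v := by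
  simpa using areaSum_le_of_orthonormal A (θ := 1)
    (fun u v hu hv _ => areaSum_le_one A hA N hu hv) u v

theorem areaSum_antitone (hA : ∑ x, star (A x) * A x = 1) (u v : H) :
    Antitone fun N => areaSum A N u v :=
  antitone_nat_of_succ_le fun N => by
    rw [areaSum_add]
    exact Finset.sum_le_sum fun x _ => areaSum_le_area A hA 1 _ _

/-- If the total area does not decrease, then every product is a multiple of an isometry on the
span of the two vectors. -/
theorem conformal_of_areaSum_eq_one (hA : ∑ x, star (A x) * A x = 1) {N : ℕ} {u v : H}
    (hu : ‖u‖ = 1) (hv : ‖v‖ = 1) (h : 1 ≤ areaSum A N u v) (x : Fin N → Fin d) :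
    ‖wordProd A N x u‖ = ‖wordProd A N x v‖ ∧
      inner ℂ (wordProd A N x u) (wordProd A N x v) = 0 := by
  have h1 := sum_norm_sq_wordProd A hA N u
  have h2 := sum_norm_sq_wordProd A hA N v
  have hle (x : Fin N → Fin d) : area (wordProd A N x u) (wordProd A N x v) ≤
      (‖wordProd A N x u‖ ^ 2 + ‖wordProd A N x v‖ ^ 2) / 2 :=
    (area_le_mul_norm _ _).trans (by
      nlinarith [sq_nonneg (‖wordProd A N x u‖ - ‖wordProd A N x v‖)])
  have hsum : ∑ x, (‖wordProd A N x u‖ ^ 2 + ‖wordProd A N x v‖ ^ 2) / 2 = 1 := by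
    rw [← Finset.sum_div, Finset.sum_add_distrib, h1, h2, hu, hv]; norm_num
  have heq := (Finset.sum_eq_sum_iff_of_le fun x _ => hle x).1
    (le_antisymm (Finset.sum_le_sum fun x _ => hle x) (hsum.trans_le h)) x (Finset.mem_univ x)
  have hsq := area_sq (wordProd A N x u) (wordProd A N x v)
  rw [heq] at hsq
  -- With `p = ‖W u‖ ^ 2` and `q = ‖W v‖ ^ 2`, equality makes the squared area both `((p + q) / 2) ^
  -- 2` and `p q - |⟨W u, W v⟩| ^ 2`.
  have hs : ((‖wordProd A N x u‖ ^ 2 - ‖wordProd A N x v‖ ^ 2) / 2) ^ 2 +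
      ‖inner ℂ (wordProd A N x u) (wordProd A N x v)‖ ^ 2 = 0 := by linarith
  have e1 := pow_eq_zero_iff two_ne_zero |>.1
    ((add_eq_zero_iff_of_nonneg (sq_nonneg _) (sq_nonneg _)).1 hs).1
  have e2 := pow_eq_zero_iff two_ne_zero |>.1
    ((add_eq_zero_iff_of_nonneg (sq_nonneg _) (sq_nonneg _)).1 hs).2
  refine ⟨?_, norm_eq_zero.1 e2⟩
  rw [← sq_eq_sq₀ (norm_nonneg _) (norm_nonneg _)]
  linarith

/-- Otherwise all products are conformal on the span of `u` and `v`, and its projector, of rank two,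
contradicts purity. -/
theorem exists_areaSum_lt_one (hA : ∑ x, star (A x) * A x = 1) (hP : Purity A) {u v : H}
    (hu : ‖u‖ = 1) (hv : ‖v‖ = 1) (huv : inner ℂ u v = 0) : ∃ N, areaSum A N u v < 1 := by
  by_contra! hcon
  let K : Submodule ℂ H := Submodule.span ℂ {u, v}
  have hind : LinearIndependent ℂ ![u, v] := by
    have : Orthonormal ℂ ![u, v] := by
      simp [orthonormal_vecCons_iff, hu, hv, huv]
    exact this.linearIndependent
  have hK : Module.finrank ℂ K = 2 := by
    have := finrank_span_eq_card hind
    rwa [Matrix.range_cons_cons_empty, Fintype.card_fin] at this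
  have : FiniteDimensional ℂ K := FiniteDimensional.of_finrank_eq_succ hK
  have hrank : opRank K.starProjection = 2 := by
    rw [opRank, ← hK, Submodule.range_starProjection K]
  have h1 := hP K.starProjection isStarProjection_starProjection (fun h0 => by
    rw [h0, opRank, ContinuousLinearMap.toLinearMap_zero, LinearMap.range_zero,
      finrank_bot] at hrank
    omega) fun N x => ?_
  · omega
  obtain ⟨hn, h0⟩ := conformal_of_areaSum_eq_one A hA hu hv (hcon N) x
  set W := wordProd A N x
  have h0' : inner ℂ (W v) (W u) = 0 := inner_eq_zero_symm.1 h0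
  have hvu : inner ℂ v u = 0 := inner_eq_zero_symm.1 huv
  have hW : ∀ a ∈ K, ∀ b ∈ K, inner ℂ (W a) (W b) = (‖W u‖ ^ 2 : ℝ) * inner ℂ a b := by
    intro a ha b hb
    obtain ⟨a₁, a₂, rfl⟩ := Submodule.mem_span_pair.1 ha
    obtain ⟨b₁, b₂, rfl⟩ := Submodule.mem_span_pair.1 hb
    simp only [map_add, map_smul, inner_add_left, inner_add_right, inner_smul_left,
      inner_smul_right, h0, h0', huv, hvu, inner_self_eq_norm_sq_to_K, hu, hv, hn]
    simp
    ring
  refine ⟨(‖W u‖ ^ 2 : ℝ), ContinuousLinearMap.ext fun y => ext_inner_left ℂ fun z => ?_⟩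
  simp only [mul_apply_eq_comp, smul_apply]
  rw [← Submodule.inner_starProjection_left_eq_right, ContinuousLinearMap.star_eq_adjoint,
    ContinuousLinearMap.adjoint_inner_right, hW _ (Submodule.starProjection_apply_mem _ _) _
      (Submodule.starProjection_apply_mem _ _), inner_smul_right,
    Submodule.inner_starProjection_left_eq_right,
    Submodule.starProjection_eq_self_iff.2 (Submodule.starProjection_apply_mem _ _)]

end AreaSum

/-! ### Purity and the exponential decay of `w`. -/

/-- An antitone sequence that contracts by `θ` every `p` steps decays exponentially. -/
theorem le_exp_of_contraction {a : ℕ → ℝ} (ha : Antitone a) (h0 : ∀ n, 0 ≤ a n) {p : ℕ}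
    (hp : 0 < p) {θ : ℝ} (hθ0 : 0 < θ) (hθ1 : θ < 1) (h : ∀ n, a (n + p) ≤ θ * a n) (N : ℕ) :
    a N ≤ a 0 / θ * (θ ^ (p : ℝ)⁻¹) ^ N := by
  have hk (k r : ℕ) : a (r + k * p) ≤ θ ^ k * a r := by
    induction k with
    | zero => simp
    | succ k ih =>
      rw [Nat.succ_mul, ← Nat.add_assoc, pow_succ']
      refine (h _).trans ?_
      rw [mul_assoc]
      exact mul_le_mul_of_nonneg_left ih hθ0.le
  set γ := θ ^ (p : ℝ)⁻¹ with hγ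
  have hγp : γ ^ p = θ := Real.rpow_inv_natCast_pow hθ0.le hp.ne'
  have hγ0 : 0 < γ := Real.rpow_pos_of_pos hθ0 _
  have hγ1 : γ ≤ 1 := Real.rpow_le_one hθ0.le hθ1.le (by positivity)
  -- The factor `γ ^ p = θ` pays for the remainder `N % p < p`; hence the division by `θ` in the
  -- constant.
  have hle : γ ^ p * γ ^ (N / p * p) ≤ γ ^ N := by
    rw [← pow_add]
    refine pow_le_pow_of_le_one hγ0.le hγ1 ?_
    have := Nat.div_add_mod' N p
    have := Nat.mod_lt N hp
    omega
  calc a N ≤ a (0 + N / p * p) := ha (by simpa using Nat.div_mul_le_self N p)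
    _ ≤ θ ^ (N / p) * a 0 := hk _ _
    _ = a 0 / θ * (γ ^ p * γ ^ (N / p * p)) := by
      rw [mul_comm _ p, pow_mul, hγp]; field_simp
    _ ≤ a 0 / θ * γ ^ N := by
      have := h0 0
      gcongr

theorem norm_le_one_of_adjoint_comp_le [CompleteSpace H] {H' : Type v} [NormedAddCommGroup H']
    [InnerProductSpace ℂ H'] [CompleteSpace H'] {F : H →L[ℂ] H'}
    (hF : ContinuousLinearMap.adjoint F ∘L F ≤ 1) : ‖F‖ ≤ 1 := by
  refine F.opNorm_le_bound zero_le_one fun x => ?_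
  rw [one_mul]
  refine le_of_sq_le_sq ?_ (norm_nonneg x)
  have := ((ContinuousLinearMap.le_def _ _).1 hF).re_inner_nonneg_right x
  rw [sub_apply, inner_sub_right, ContinuousLinearMap.comp_apply,
    ContinuousLinearMap.adjoint_inner_right, one_apply_eq_self, map_sub,
    inner_self_eq_norm_sq, inner_self_eq_norm_sq] at this
  linarith

variable [FiniteDimensional ℂ H] {d : ℕ} {A : Fin d → H →L[ℂ] H}

theorem w_nonneg (A : Fin d → H →L[ℂ] H) (N : ℕ) : 0 ≤ w A N :=
  Finset.sum_nonneg fun _ _ => topTwo_nonneg _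

/-- Expand the two vectors realizing `topTwo` in the basis; their coordinates are at most one in
modulus. -/
theorem w_le_sum_areaSum (A : Fin d → H →L[ℂ] H) {ι : Type*} [Fintype ι]
    (b : OrthonormalBasis ι ℂ H) (N : ℕ) : w A N ≤ ∑ i, ∑ j, areaSum A N (b i) (b j) := by
  have hT (T : H →L[ℂ] H) : topTwo T ≤ ∑ i, ∑ j, area (T (b i)) (T (b j)) := by
    obtain ⟨u, v, hu, hv, h⟩ := exists_topTwo_eq_area T
    have hc {u : H} (hu : ‖u‖ ≤ 1) (i : ι) : ‖(inner ℂ (b i) u : ℂ)‖ ≤ 1 := by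
      refine (norm_inner_le_norm _ _).trans ?_
      simpa using hu
    have hs (u : H) : T u = ∑ i, (inner ℂ (b i) u : ℂ) • T (b i) := by
      conv_lhs => rw [← b.sum_repr' u, map_sum]
      simp only [map_smul]
    rw [h, hs u, hs v]
    exact area_sum_sum_le _ _ _ (hc hu) (hc hv)
  refine (Finset.sum_le_sum fun x _ => hT (wordProd A N x)).trans_eq ?_
  rw [Finset.sum_comm]
  refine Finset.sum_congr rfl fun i _ => ?_
  rw [Finset.sum_comm]
  rfl

variable [CompleteSpace H]

/-- The open sets where the total area at length `N` is below one increase with `N` and cover the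
compact set of orthonormal pairs, so a single `N` suffices, and the maximum there is below one. -/
theorem exists_areaSum_contraction (hA : ∑ x, star (A x) * A x = 1) (hP : Purity A) :
    ∃ (p : ℕ) (θ : ℝ), 0 < p ∧ 0 < θ ∧ θ < 1 ∧ ∀ u v, areaSum A p u v ≤ θ * area u v := by
  let S : Set (H × H) := {q | ‖q.1‖ = 1 ∧ ‖q.2‖ = 1 ∧ inner ℂ q.1 q.2 = 0}
  have hS : IsCompact S := by
    refine (isCompact_closedBall (0 : H × H) 1).of_isClosed_subset ?_ fun q hq => ?_
    · refine (isClosed_eq (by fun_prop) (by fun_prop)).inter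
        ((isClosed_eq (by fun_prop) (by fun_prop)).inter (isClosed_eq (by fun_prop) (by fun_prop)))
    · rw [mem_closedBall_zero_iff, Prod.norm_def, hq.1, hq.2.1, max_self]
  obtain ⟨N, hN⟩ := hS.elim_directed_cover (fun N => {q : H × H | areaSum A N q.1 q.2 < 1})
    (fun N => isOpen_lt (continuous_areaSum A N) continuous_const)
    (fun q hq => Set.mem_iUnion.2 (exists_areaSum_lt_one A hA hP hq.1 hq.2.1 hq.2.2))
    (Monotone.directed_le fun m n hmn q hq =>
      (areaSum_antitone A hA q.1 q.2 hmn).trans_lt hq)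
  have hsucc (u v : H) : areaSum A (N + 1) u v ≤ areaSum A N u v :=
    areaSum_antitone A hA u v N.le_succ
  -- Without orthonormal pairs any `θ` works. In both cases `N + 1` ensures a positive length, and
  -- `1 / 2` a positive `θ`.
  rcases S.eq_empty_or_nonempty with hne | hne
  · refine ⟨N + 1, 1 / 2, by omega, by norm_num, by norm_num,
      areaSum_le_of_orthonormal A fun u v hu hv huv => ?_⟩
    have : (u, v) ∈ S := ⟨hu, hv, huv⟩
    simp [hne] at this
  · obtain ⟨q, hq, hmax⟩ := hS.exists_isMaxOn hne (continuous_areaSum A N).continuousOn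
    refine ⟨N + 1, max (1 / 2) (areaSum A N q.1 q.2), by omega, by positivity,
      max_lt (by norm_num) (hN hq), areaSum_le_of_orthonormal A fun u v hu hv huv => ?_⟩
    have : (u, v) ∈ S := ⟨hu, hv, huv⟩
    exact (hsucc u v).trans ((hmax this).trans (le_max_right _ _))

theorem w_exp_of_purity (hA : ∑ x, star (A x) * A x = 1) (hP : Purity A) :
    ∃ C γ : ℝ, 0 ≤ C ∧ 0 < γ ∧ γ < 1 ∧ ∀ N, w A N ≤ C * γ ^ N := by
  obtain ⟨p, θ, hp, hθ0, hθ1, hc⟩ := exists_areaSum_contraction hA hP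
  let b := stdOrthonormalBasis ℂ H
  refine ⟨∑ i, ∑ j, areaSum A 0 (b i) (b j) / θ, θ ^ (p : ℝ)⁻¹, ?_,
    Real.rpow_pos_of_pos hθ0 _, Real.rpow_lt_one hθ0.le hθ1 (by positivity), fun N => ?_⟩
  · exact Finset.sum_nonneg fun i _ => Finset.sum_nonneg fun j _ =>
      div_nonneg (areaSum_nonneg _ _ _ _) hθ0.le
  · refine (w_le_sum_areaSum A b N).trans ?_
    simp only [Finset.sum_mul]
    refine Finset.sum_le_sum fun i _ => Finset.sum_le_sum fun j _ => ?_
    refine le_exp_of_contraction (a := fun N => areaSum A N (b i) (b j))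
      (areaSum_antitone A hA _ _) (fun n => areaSum_nonneg A n _ _) hp hθ0 hθ1 (fun n => ?_) N
    rw [areaSum_add, areaSum, Finset.mul_sum]
    exact Finset.sum_le_sum fun x _ => hc _ _

/-- An offending projector has rank at least two. For an orthonormal pair in its range each product
satisfies `‖W u‖ ^ 2 = area (W u) (W v) ≤ topTwo W`, and the left sides sum to one. -/
theorem one_le_w_of_not_purity (hA : ∑ x, star (A x) * A x = 1) (hP : ¬ Purity A) (N : ℕ) :
    1 ≤ w A N := by
  rw [Purity] at hP
  push Not at hP
  obtain ⟨P, hproj, hP0, hc, hrank⟩ := hP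
  have h2 : 1 < Module.finrank ℂ P.range := by
    have : Module.finrank ℂ P.range ≠ 0 := fun h0 => hP0 <| by
      have := LinearMap.range_eq_bot.1 (Submodule.finrank_eq_zero.1 h0)
      exact ContinuousLinearMap.coe_injective this
    have : Module.finrank ℂ P.range ≠ 1 := hrank
    omega
  let b := stdOrthonormalBasis ℂ P.range
  have hfix (y : P.range) : P y = y := by
    obtain ⟨_, z, rfl⟩ := y
    exact DFunLike.congr_fun hproj.isIdempotentElem.eq z
  have hadj (y z : H) : inner ℂ (P y) z = inner ℂ y (P z) := by
    rw [← ContinuousLinearMap.adjoint_inner_right, ← ContinuousLinearMap.star_eq_adjoint,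
      hproj.isSelfAdjoint.star_eq]
  set u := b ⟨0, by omega⟩
  set v := b ⟨1, by omega⟩
  have hu : ‖(u : H)‖ = 1 := b.norm_eq_one _
  have hv : ‖(v : H)‖ = 1 := b.norm_eq_one _
  have huv : inner ℂ (u : H) (v : H) = 0 := by
    rw [← Submodule.coe_inner, b.inner_eq_ite, if_neg (by simp)]
  rw [w]
  calc (1 : ℝ) = ∑ x, ‖wordProd A N x u‖ ^ 2 := by
        rw [sum_norm_sq_wordProd A hA, hu, one_pow]
    _ ≤ _ := Finset.sum_le_sum fun x _ => ?_
  obtain ⟨c, hcx⟩ := hc N x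
  set W := wordProd A N x
  have hW (y z : P.range) : inner ℂ (W y) (W z) = c * inner ℂ (y : H) (z : H) := by
    have := congrArg (fun T : H →L[ℂ] H => inner ℂ (y : H) (T z)) hcx
    simp only [mul_apply_eq_comp, smul_apply, inner_smul_right, hfix] at this
    rwa [← hadj, hfix, ContinuousLinearMap.star_eq_adjoint,
      ContinuousLinearMap.adjoint_inner_right] at this
  have hn : ‖W u‖ ^ 2 = ‖W v‖ ^ 2 := by
    apply Complex.ofReal_injective
    have e1 := hW u u
    have e2 := hW v v
    rw [inner_self_eq_norm_sq_to_K, inner_self_eq_norm_sq_to_K, hu] at e1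
    rw [inner_self_eq_norm_sq_to_K, inner_self_eq_norm_sq_to_K, hv] at e2
    simpa using e1.trans e2.symm
  have hn' : ‖W u‖ = ‖W v‖ := (sq_eq_sq₀ (norm_nonneg _) (norm_nonneg _)).1 hn
  have h1 := area_map_le_topTwo W (u : H) v
  rw [area_of_inner_eq_zero huv, area_of_inner_eq_zero (by rw [hW, huv, mul_zero]), ← hn',
    hu, hv, mul_one, mul_one, ← sq] at h1
  exact h1

/-! ### Comparison of `f` with `w`. -/

theorem norm_sqrt_le_one {σ : H →L[ℂ] H} (hσ : IsDensityOperator σ) : ‖CFC.sqrt σ‖ ≤ 1 := by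
  have hpos : 0 ≤ σ := (ContinuousLinearMap.nonneg_iff_isPositive σ).2 hσ.1
  set s := CFC.sqrt σ with hs
  have hss : s * s = σ := CFC.sqrt_mul_sqrt_self σ hpos
  have hsa : IsSelfAdjoint s := (CFC.sqrt_nonneg σ).isSelfAdjoint
  let b := stdOrthonormalBasis ℂ H
  -- The squared Hilbert–Schmidt norm of `√σ` is the trace of `σ`; by Cauchy–Schwarz it dominates
  -- the squared operator norm.
  have hsum : ∑ i, ‖s (b i)‖ ^ 2 = 1 := by
    apply Complex.ofReal_injective
    have := LinearMap.trace_eq_sum_inner (σ : H →ₗ[ℂ] H) b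
    rw [hσ.2] at this
    rw [Complex.ofReal_one, this, Complex.ofReal_sum]
    refine Finset.sum_congr rfl fun i _ => ?_
    rw [ContinuousLinearMap.coe_coe, ← hss, mul_apply_eq_comp,
      ← ContinuousLinearMap.adjoint_inner_left, ← ContinuousLinearMap.star_eq_adjoint, hsa.star_eq,
      inner_self_eq_norm_sq_to_K]
    simp
  refine s.opNorm_le_bound zero_le_one fun x => ?_
  rw [one_mul]
  refine le_of_sq_le_sq ?_ (norm_nonneg x)
  calc ‖s x‖ ^ 2 = ‖∑ i, (inner ℂ (b i) x : ℂ) • s (b i)‖ ^ 2 := by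
        conv_lhs => rw [← b.sum_repr' x, map_sum]
        simp only [map_smul]
    _ ≤ (∑ i, ‖(inner ℂ (b i) x : ℂ)‖ * ‖s (b i)‖) ^ 2 := by
        gcongr
        exact (norm_sum_le _ _).trans_eq (by simp only [norm_smul])
    _ ≤ (∑ i, ‖(inner ℂ (b i) x : ℂ)‖ ^ 2) * ∑ i, ‖s (b i)‖ ^ 2 :=
        Finset.sum_mul_sq_le_sq_mul_sq _ _ _
    _ = ‖x‖ ^ 2 := by rw [hsum, mul_one, b.sum_sq_norm_inner_right]

variable {H' : Type v} [NormedAddCommGroup H'] [InnerProductSpace ℂ H'] [CompleteSpace H']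
  [FiniteDimensional ℂ H']

theorem f_le_w (A : Fin d → H →L[ℂ] H) {σ : H →L[ℂ] H} {F : H →L[ℂ] H'}
    (hσ : IsDensityOperator σ) (hF : ContinuousLinearMap.adjoint F ∘L F ≤ 1) (N : ℕ) :
    f A σ F N ≤ w A N := by
  have h1 := norm_sqrt_le_one hσ
  have h2 := norm_le_one_of_adjoint_comp_le hF
  refine Finset.sum_le_sum fun x _ => (topTwo_comp_le _ _ _).trans ?_
  refine mul_le_of_le_one_left (topTwo_nonneg _) ?_
  exact mul_le_one₀ (mul_le_one₀ h2 (norm_nonneg _) h2) (by positivity)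
    (mul_le_one₀ h1 (norm_nonneg _) h1)

/-- Full rank makes `√σ` surjective and `F` injective. With a right inverse `R` and a left inverse
`L`, each product is `W = L (F W √σ) R`, so the constant depends only on the norms of `L` and `R`.
-/
theorem w_le_mul_f (A : Fin d → H →L[ℂ] H) {σ : H →L[ℂ] H} {F : H →L[ℂ] H'}
    (hσ : σ.IsPositive) (hσr : IsFullRank σ)
    (hF : IsFullRank (ContinuousLinearMap.adjoint F ∘L F)) :
    ∃ K : ℝ, 0 ≤ K ∧ ∀ N, w A N ≤ K * f A σ F N := by
  have hpos : 0 ≤ σ := (ContinuousLinearMap.nonneg_iff_isPositive σ).2 hσ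
  set s := CFC.sqrt σ with hs
  have hss : s * s = σ := CFC.sqrt_mul_sqrt_self σ hpos
  have hrange : LinearMap.range (s : H →ₗ[ℂ] H) = ⊤ := by
    refine top_le_iff.1 ((Submodule.eq_top_of_finrank_eq hσr).symm.trans_le ?_)
    rintro _ ⟨x, rfl⟩
    exact ⟨s x, DFunLike.congr_fun hss x⟩
  have hker : LinearMap.ker (F : H →ₗ[ℂ] H') = ⊥ := by
    have h1 : LinearMap.range ((ContinuousLinearMap.adjoint F ∘L F : H →L[ℂ] H) : H →ₗ[ℂ] H) = ⊤ :=
      Submodule.eq_top_of_finrank_eq hF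
    have h2 := LinearMap.ker_eq_bot_iff_range_eq_top.2 h1
    refine eq_bot_iff.2 fun x hx => h2 ▸ ?_
    rw [LinearMap.mem_ker] at hx ⊢
    simp only [ContinuousLinearMap.coe_coe] at hx
    simp [hx]
  obtain ⟨R, hR⟩ := (s : H →ₗ[ℂ] H).exists_rightInverse_of_surjective hrange
  obtain ⟨L, hL⟩ := (F : H →ₗ[ℂ] H').exists_leftInverse_of_injective hker
  refine ⟨‖LinearMap.toContinuousLinearMap L‖ * ‖LinearMap.toContinuousLinearMap L‖ *
    (‖LinearMap.toContinuousLinearMap R‖ * ‖LinearMap.toContinuousLinearMap R‖), by positivity,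
    fun N => ?_⟩
  rw [f, Finset.mul_sum]
  refine Finset.sum_le_sum fun x _ => ?_
  refine le_of_eq_of_le (congrArg topTwo ?_) (topTwo_comp_le (LinearMap.toContinuousLinearMap L)
    (F ∘L wordProd A N x ∘L CFC.sqrt σ) (LinearMap.toContinuousLinearMap R))
  ext y
  have h1 := LinearMap.congr_fun hR y
  have h2 := LinearMap.congr_fun hL (wordProd A N x y)
  simp only [LinearMap.comp_apply, LinearMap.id_apply, ContinuousLinearMap.coe_coe] at h1 h2
  simp only [ContinuousLinearMap.comp_apply, LinearMap.coe_toContinuousLinearMap', ← hs, h1, h2]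

end RandomProducts

end

theorem mainTheorem3 {H : Type u} [NormedAddCommGroup H] [InnerProductSpace ℂ H]
    [CompleteSpace H] [FiniteDimensional ℂ H] (d : ℕ) (A : Fin d → H →L[ℂ] H)
    (hA : ∑ x, star (A x) * A x = 1) :
    (RandomProducts.Purity A →
      ∃ c γ : ℝ, 0 ≤ c ∧ 0 < γ ∧ γ < 1 ∧
        ∀ (H' : Type v) [NormedAddCommGroup H'] [InnerProductSpace ℂ H'] [CompleteSpace H']
          [FiniteDimensional ℂ H'] (σ : H →L[ℂ] H) (F : H →L[ℂ] H'),
          RandomProducts.IsDensityOperator σ →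
          ContinuousLinearMap.adjoint F ∘L F ≤ 1 →
          ∀ N : ℕ, RandomProducts.f A σ F N ≤ c * γ ^ N) ∧
    (∀ (H' : Type v) [NormedAddCommGroup H'] [InnerProductSpace ℂ H'] [CompleteSpace H']
      [FiniteDimensional ℂ H'] (σ : H →L[ℂ] H) (F : H →L[ℂ] H'),
      σ.IsPositive → RandomProducts.IsFullRank σ →
      RandomProducts.IsFullRank (ContinuousLinearMap.adjoint F ∘L F) →
      (∃ c γ : ℝ, 0 ≤ c ∧ 0 < γ ∧ γ < 1 ∧ ∀ N : ℕ, RandomProducts.f A σ F N ≤ c * γ ^ N) →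
      RandomProducts.Purity A) ∧
    List.TFAE [
      RandomProducts.Purity A,
      Tendsto (RandomProducts.w A) atTop (𝓝 0),
      ∃ C γ : ℝ, 0 ≤ C ∧ 0 < γ ∧ γ < 1 ∧ ∀ N : ℕ, RandomProducts.w A N ≤ C * γ ^ N] := by
  have hba : Tendsto (RandomProducts.w A) atTop (𝓝 0) → RandomProducts.Purity A := fun h => by
    by_contra hP
    have := ge_of_tendsto' h (RandomProducts.one_le_w_of_not_purity hA hP)
    norm_num at this
  have hcb : (∃ C γ : ℝ, 0 ≤ C ∧ 0 < γ ∧ γ < 1 ∧ ∀ N : ℕ, RandomProducts.w A N ≤ C * γ ^ N) →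
      Tendsto (RandomProducts.w A) atTop (𝓝 0) := by
    rintro ⟨C, γ, -, h0, h1, h⟩
    refine squeeze_zero (RandomProducts.w_nonneg A) h ?_
    simpa using (tendsto_pow_atTop_nhds_zero_of_lt_one h0.le h1).const_mul C
  refine ⟨fun hP => ?_, ?_, ?_⟩
  · obtain ⟨C, γ, hC, h0, h1, h⟩ := RandomProducts.w_exp_of_purity hA hP
    refine ⟨C, γ, hC, h0, h1, ?_⟩
    intro H' _ _ _ _ σ F hσ hF N
    exact (RandomProducts.f_le_w A hσ hF N).trans (h N)
  · rintro H' _ _ _ _ σ F hσ hσr hF ⟨c, γ, hc, h0, h1, h⟩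
    obtain ⟨K, hK, hw⟩ := RandomProducts.w_le_mul_f A hσ hσr hF
    refine hba (hcb ⟨K * c, γ, mul_nonneg hK hc, h0, h1, fun N => (hw N).trans ?_⟩)
    rw [mul_assoc]
    exact mul_le_mul_of_nonneg_left (h N) hK
  · tfae_have 1 → 3 := RandomProducts.w_exp_of_purity hA
    tfae_have 3 → 2 := hcb
    tfae_have 2 → 1 := hba
    tfae_finish
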